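/- \textbf{Theorem (modular exponentiation needs $\mathbb{Z}$).} Let $M\ge 2$ be an integer, let $\mathbf{B}$ be a finite Abelian (black-box) group, written multiplicatively, and let $a\in\mathbf{B}$. Let $\mathcal{H}_M\otimes\mathcal{H}_{\mathbf{B}}$ be the finite-dimensional Hilbert space with orthonormal standard basis $\{|m,x\rangle : m\in\mathbb{Z}_M,\ x\in\mathbf{B}\}$, and let $U_{\mathrm{me}}$ be the unitary operator with $U_{\mathrm{me}}|m,x\rangle=|m,a^m x\rangle$ for $m\in\{0,\ldots,M-1\}$ and $x\in\mathbf{B}$. Write $G=\mathbb{Z}_M\times\mathbf{B}$ additively. A \emph{normalizer gate} over $G$ is one of the following operators on $\mathcal{H}_M\otimes\mathcal{H}_{\mathbf{B}}$: an automorphism gate $|h\rangle\mapsto|\alpha(h)\rangle$, where $\alpha$ is a group automorphism of $G$; a quadratic phase gate $|h\rangle\mapsto\xi(h)|h\rangle$, where $\xi:G\to U(1)$ satisfies $\xi(g+h)=\xi(g)\xi(h)\beta(g,h)$ for all $g,h\in G$ and some $\beta:G\times G\to U(1)$ that is a character in each argument; or the quantum Fourier transform $|x\rangle\mapsto M^{-1/2}\sum_{y\in\mathbb{Z}_M}e^{2\pi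 i xy/M}|y\rangle$ acting on the register $\mathcal{H}_M$. A \emph{normalizer circuit} over $G$ is a finite product $\mathcal{C}=U_T\cdots U_1$ of normalizer gates, of any size $T$. Then, unless $M$ is a multiple of the order of $a$, there is no normalizer circuit $\mathcal{C}$ over $\mathbb{Z}_M\times\mathbf{B}$, of any size, such that $$\|\mathcal{C}-U_{\mathrm{me}}\|_{\mathrm{op}}\le 1-2^{-1/2}.$$ -/

import Mathlib

open scoped Kronecker

namespace NormalizerCircuits

section Gates

variable {G : Type*}

/-- The matrix, in the standard basis `{|g⟩ : g ∈ G}`, of the linear map `|h⟩ ↦ |f h⟩`. -/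
def basisMap [DecidableEq G] (f : G → G) : Matrix G G ℂ :=
  Matrix.of fun g h => if g = f h then 1 else 0

/-- `χ : G → U(1)` is a character: `χ(g + h) = χ(g) χ(h)`. -/
def IsCharacter [AddCommGroup G] (χ : G → Circle) : Prop :=
  ∀ g h, χ (g + h) = χ g * χ h

/-- `β : G × G → U(1)` is a bicharacter: it is a character in both arguments. -/
def IsBicharacter [AddCommGroup G] (β : G → G → Circle) : Prop :=
  (∀ g, IsCharacter fun h => β g h) ∧ ∀ h, IsCharacter fun g => β g h

/-- `ξ : G → U(1)` is quadratic: `ξ(g + h) = ξ(g) ξ(h) β(g, h)` for some bicharacter `β`. -/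
def IsQuadratic [AddCommGroup G] (ξ : G → Circle) : Prop :=
  ∃ β : G → G → Circle, IsBicharacter β ∧ ∀ g h, ξ (g + h) = ξ g * ξ h * β g h

end Gates

/-- The group `ℤ_M × 𝐁` that labels the standard basis of `H_M ⊗ H_𝐁`. The group `𝐁` is written
multiplicatively; `Additive B` is the same group in additive notation. -/
abbrev LabelGroup (M : ℕ) (B : Type*) : Type _ := ZMod M × Additive B

/-- The Hilbert space `H_M ⊗ H_𝐁`, with orthonormal standard basis `|m, x⟩`, `(m, x) ∈ ℤ_M × 𝐁`. -/
abbrev StateSpace (M : ℕ) (B : Type*) : Type _ := EuclideanSpace ℂ (LabelGroup M B)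

/-- The quantum Fourier transform over `ℤ_M`: the matrix with entries `M^{-1/2} exp(2πi x y / M)`
(`ZMod.stdAddChar` is the character `j ↦ exp(2πi j / M)`). -/
noncomputable def qft (M : ℕ) [NeZero M] : Matrix (ZMod M) (ZMod M) ℂ :=
  Matrix.of fun y x => ((Real.sqrt (M : ℝ) : ℝ) : ℂ)⁻¹ * ZMod.stdAddChar (x * y)

/-- The normalizer gates over `ℤ_M × 𝐁`: automorphism gates `U_α : |h⟩ ↦ |α h⟩` and quadratic phase
gates `D_ξ : |h⟩ ↦ ξ(h) |h⟩` acting on the whole system, and the quantum Fourier transform acting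
on the register `H_M` (no Fourier transform acts on the black-box register). -/
inductive NormalizerGate (M : ℕ) (B : Type*) [CommGroup B] : Type _
  | automorphism (α : LabelGroup M B ≃+ LabelGroup M B)
  | quadraticPhase (ξ : LabelGroup M B → Circle) (hξ : IsQuadratic ξ)
  | fourier

/-- The matrix of a normalizer gate in the standard basis. -/
noncomputable def NormalizerGate.toMatrix {M : ℕ} [NeZero M] {B : Type*} [CommGroup B]
    [DecidableEq B] : NormalizerGate M B → Matrix (LabelGroup M B) (LabelGroup M B) ℂ
  | .automorphism α => basisMap α
  | .quadraticPhase ξ _ => Matrix.diagonal fun g => (ξ g : ℂ)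
  | .fourier => qft M ⊗ₖ (1 : Matrix (Additive B) (Additive B) ℂ)

/-- The matrix `U_T ⋯ U_1` of the normalizer circuit that applies the gates of the list
`[U_1, …, U_T]` one after the other, `U_1` first. Its size `T` is the length of the list. -/
noncomputable def circuitMatrix {M : ℕ} [NeZero M] {B : Type*} [CommGroup B] [Fintype B]
    [DecidableEq B] :
    List (NormalizerGate M B) → Matrix (LabelGroup M B) (LabelGroup M B) ℂ
  | [] => 1
  | U :: Us => circuitMatrix Us * U.toMatrix

/-- The operator on `H_M ⊗ H_𝐁` that a normalizer circuit implements. -/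
noncomputable def circuitOperator {M : ℕ} [NeZero M] {B : Type*} [CommGroup B] [Fintype B]
    [DecidableEq B] (C : List (NormalizerGate M B)) : StateSpace M B →L[ℂ] StateSpace M B :=
  Matrix.toEuclideanCLM (𝕜 := ℂ) (circuitMatrix C)

/-- The modular exponentiation gate `U_me : |m, x⟩ ↦ |m, a ^ m x⟩` on `H_M ⊗ H_𝐁`, where
`m ∈ {0, …, M - 1}`. -/
noncomputable def modularExponentiation (M : ℕ) [NeZero M] {B : Type*} [CommGroup B] [Fintype B]
    [DecidableEq B] (a : B) : StateSpace M B →L[ℂ] StateSpace M B :=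
  Matrix.toEuclideanCLM (𝕜 := ℂ)
    (basisMap fun p : LabelGroup M B => (p.1, Additive.ofMul (a ^ p.1.val * p.2.toMul)))

end NormalizerCircuits

/-!
A normalizer circuit is a Clifford operation: conjugation by any of its gates sends a generalized
Pauli operator `|h⟩ ↦ χ(h) |h + u⟩`, with `χ` a character, to a scalar multiple of another one. In
coordinates this is the property `NormalizesPaulis`, which is closed under products and holds for
each kind of gate; the Fourier transform over `ℤ_M` is the one case that uses that every character
of `ℤ_M` has the form `x ↦ exp(2πi k x / M)`.

Conjugating the translation `|h⟩ ↦ |h + g⟩` shows that the moduli of the entries of a circuit matrix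
`C` satisfy `|C (k, h + g)| = |C (k - u, h)|`, where `u` depends on `g` only. If moreover `C` is
within `1 - 2 ^ (-1/2)` of the operator `|h⟩ ↦ |f h⟩` in operator norm, then every entry of `C` at a
position `(f h, h)` has modulus at least `2 ^ (-1/2)`, and every other entry has modulus at most
`1 - 2 ^ (-1/2)`, which is smaller. Comparing the two sides at `k = f (h + g)` forces
`f (h + g) = f h + u`, so `f` is a homomorphism up to the constant `f 0`
(`map_add_of_norm_sub_basisMap_le`).

The map `f (m, x) = (m, a ^ m x)` of modular exponentiation fixes `0` and sends `(1, 1)` to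
`(1, a)`. If it is additive, then it sends `M • (1, 1) = 0` to `M • (1, a) = (0, a ^ M)`, hence
`a ^ M = 1`.
-/

namespace NormalizerCircuits

/-! ### Matrices that normalize the Pauli group -/

section Pauli

variable {G : Type*} [AddCommGroup G]

/-- The matrix `U` intertwines every generalized Pauli operator with another one: for every Pauli
operator `P : |h⟩ ↦ χ(h) |h + u⟩` there are a Pauli operator `P' : |k⟩ ↦ χ'(k) |k + u'⟩` and a
unimodular scalar `c` with `U P = c • P' U`. This is stated entrywise, and the constant `χ'(u')⁻¹`
that comes from evaluating `χ'` at the row index `k` rather than at `k - u'` is absorbed in `c`. -/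
def NormalizesPaulis (U : Matrix G G ℂ) : Prop :=
  ∀ (u : G) (χ : AddChar G Circle), ∃ (u' : G) (χ' : AddChar G Circle) (c : Circle),
    ∀ k h, U k (h + u) * χ h = c * χ' k * U (k - u') h

theorem NormalizesPaulis.one [DecidableEq G] : NormalizesPaulis (1 : Matrix G G ℂ) := by
  intro u χ
  refine ⟨u, χ, χ (-u), fun k h => ?_⟩
  by_cases hk : k = h + u
  · subst hk
    rw [add_sub_cancel_right, Matrix.one_apply_eq, Matrix.one_apply_eq, one_mul, mul_one,
      ← Circle.coe_mul, ← AddChar.map_add_eq_mul, neg_add_cancel_comm_assoc]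
  · rw [Matrix.one_apply_ne hk, Matrix.one_apply_ne (by rwa [ne_eq, sub_eq_iff_eq_add])]
    simp

theorem NormalizesPaulis.mul [Fintype G] {V U : Matrix G G ℂ} (hV : NormalizesPaulis V)
    (hU : NormalizesPaulis U) : NormalizesPaulis (V * U) := by
  intro u χ
  obtain ⟨v, ψ, c, hc⟩ := hU u χ
  obtain ⟨w, φ, d, hd⟩ := hV v ψ
  refine ⟨w, φ, c * ψ v * d, fun k h => ?_⟩
  calc (V * U) k (h + u) * χ h
      = ∑ j, V k j * (c * ψ j * U (j - v) h) := by
        simp_rw [Matrix.mul_apply, Finset.sum_mul, mul_assoc, hc, mul_assoc]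
    _ = ∑ j, V k (j + v) * (c * ψ (j + v) * U j h) := by
        rw [← Equiv.sum_comp (Equiv.addRight v)]
        simp
    _ = ∑ j, c * ψ v * (V k (j + v) * ψ j) * U j h := by
        refine Finset.sum_congr rfl fun j _ => ?_
        rw [AddChar.map_add_eq_mul, Circle.coe_mul]
        ring
    _ = (c * ψ v * d : Circle) * φ k * (V * U) (k - w) h := by
        simp_rw [hd, Matrix.mul_apply, Finset.mul_sum, Circle.coe_mul]
        exact Finset.sum_congr rfl fun j _ => by ring

/-! ### The gates -/

theorem normalizesPaulis_basisMap [DecidableEq G] (α : G ≃+ G) :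
    NormalizesPaulis (basisMap α) := by
  intro u χ
  refine ⟨α u, χ.compAddMonoidHom α.symm, χ (-u), fun k h => ?_⟩
  by_cases hk : k = α (h + u)
  · have hk' : k - α u = α h := by rw [hk, map_add, add_sub_cancel_right]
    simp only [basisMap, Matrix.of_apply, if_pos hk, if_pos hk', one_mul, mul_one]
    rw [← Circle.coe_mul, hk]
    simp [AddChar.map_add_eq_mul, AddChar.map_neg_eq_inv]
  · have hk' : ¬ k - α u = α h := by rwa [sub_eq_iff_eq_add, ← map_add]
    simp only [basisMap, Matrix.of_apply, if_neg hk, if_neg hk', zero_mul, mul_zero]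

/-- A character as a bundled additive character. -/
def IsCharacter.toAddChar {χ : G → Circle} (hχ : IsCharacter χ) : AddChar G Circle where
  toFun := χ
  map_zero_eq_one' := by simpa using hχ 0 0
  map_add_eq_mul' := hχ

theorem normalizesPaulis_diagonal [DecidableEq G] {ξ : G → Circle} (hξ : IsQuadratic ξ) :
    NormalizesPaulis (Matrix.diagonal fun g => (ξ g : ℂ)) := by
  obtain ⟨β, ⟨-, hβ⟩, hξβ⟩ := hξ
  intro u χ
  let ψ : AddChar G Circle := χ * (hβ u).toAddChar
  refine ⟨u, ψ, ξ u * ψ (-u), fun k h => ?_⟩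
  by_cases hk : k = h + u
  · subst hk
    simp only [Matrix.diagonal_apply_eq, add_sub_cancel_right]
    simp only [← Circle.coe_mul]
    congr 1
    rw [hξβ, AddChar.map_add_eq_mul ψ, AddChar.map_neg_eq_inv ψ]
    have hψ : ψ h = χ h * β h u := rfl
    calc ξ h * ξ u * β h u * χ h = ξ h * ξ u * ψ h := by rw [hψ]; ac_rfl
      _ = ξ u * (ψ u)⁻¹ * (ψ h * ψ u) * ξ h := by
        rw [mul_comm (ψ h), ← mul_assoc, inv_mul_cancel_right]
        ac_rfl
  · rw [Matrix.diagonal_apply_ne' _ (Ne.symm hk),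
      Matrix.diagonal_apply_ne _ (by rwa [ne_eq, sub_eq_iff_eq_add])]
    simp

end Pauli

/-- Every character of `ℤ_M` is of the form `x ↦ exp(2πi k x / M)`. -/
theorem exists_eq_toCircle_mul {M : ℕ} [NeZero M] (χ : AddChar (ZMod M) Circle) :
    ∃ k : ZMod M, ∀ x, χ x = ZMod.toCircle (k * x) := by
  obtain ⟨k, hk⟩ := AddChar.zmodAddEquiv.surjective (AddChar.circleEquivComplex χ)
  rw [AddChar.zmodAddEquiv_apply] at hk
  exact ⟨k, fun x => (DFunLike.congr_fun (AddChar.circleEquivComplex.injective hk) x).symm⟩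

/-- The Fourier transform on the first register exchanges the translation by `u` and the character
`x ↦ exp(2πi k x / M)` of that register, and leaves the Pauli operators of the second one alone. -/
theorem normalizesPaulis_qft_kronecker_one (M : ℕ) [NeZero M] {A : Type*} [AddCommGroup A]
    [DecidableEq A] :
    NormalizesPaulis (Matrix.kronecker (qft M) (1 : Matrix A A ℂ)) := by
  rintro ⟨u, v⟩ χ
  let χ₂ : AddChar A Circle := χ.compAddMonoidHom (AddMonoidHom.inr (ZMod M) A)
  obtain ⟨k, hk⟩ := exists_eq_toCircle_mul (χ.compAddMonoidHom (AddMonoidHom.inl (ZMod M) A))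
  have hχ (x : ZMod M) (b : A) : χ (x, b) = ZMod.toCircle (k * x) * χ₂ b := by
    rw [← hk]
    simp only [χ₂, AddChar.compAddMonoidHom_apply, ← AddChar.map_add_eq_mul]
    simp
  let χ' : AddChar (ZMod M × A) Circle :=
    (AddChar.mulShift ZMod.toCircle u).compAddMonoidHom (AddMonoidHom.fst (ZMod M) A) *
      χ₂.compAddMonoidHom (AddMonoidHom.snd (ZMod M) A)
  have hχ' (y : ZMod M) (b : A) : χ' (y, b) = ZMod.toCircle (u * y) * χ₂ b := rfl
  refine ⟨(-k, v), χ', χ₂ (-v), ?_⟩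
  rintro ⟨y, b⟩ ⟨x, b'⟩
  rw [hχ, hχ']
  simp only [Matrix.kronecker, Matrix.kroneckerMap_apply, qft, Matrix.of_apply, Prod.mk_add_mk,
    Prod.mk_sub_mk, ZMod.stdAddChar_apply]
  by_cases hb : b = b' + v
  · subst hb
    rw [add_sub_cancel_right, Matrix.one_apply_eq, Matrix.one_apply_eq, mul_one, mul_one]
    have key : ZMod.toCircle ((x + u) * y) * (ZMod.toCircle (k * x) * χ₂ b') =
        χ₂ (-v) * (ZMod.toCircle (u * y) * χ₂ (b' + v)) * ZMod.toCircle (x * (y - -k)) := by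
      rw [show x * (y - -k) = x * y + k * x by ring, add_mul]
      simp only [AddChar.map_add_eq_mul, AddChar.map_neg_eq_inv]
      rw [mul_comm (χ₂ b'), mul_left_comm _ (χ₂ v), inv_mul_cancel_left]
      ac_rfl
    calc _ = ((Real.sqrt M : ℝ) : ℂ)⁻¹ *
          (ZMod.toCircle ((x + u) * y) * (ZMod.toCircle (k * x) * χ₂ b') : Circle) := by
          push_cast
          ring
      _ = _ := by
          rw [key]
          push_cast
          ring
  · rw [Matrix.one_apply_ne hb, Matrix.one_apply_ne (by rwa [ne_eq, sub_eq_iff_eq_add])]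
    simp

theorem normalizesPaulis_circuitMatrix {M : ℕ} [NeZero M] {B : Type*} [CommGroup B] [Fintype B]
    [DecidableEq B] (C : List (NormalizerGate M B)) : NormalizesPaulis (circuitMatrix C) := by
  induction C with
  | nil => exact .one
  | cons U Us ih =>
    refine ih.mul ?_
    cases U with
    | automorphism α => exact normalizesPaulis_basisMap α
    | quadraticPhase ξ hξ => exact normalizesPaulis_diagonal hξ
    | fourier => exact normalizesPaulis_qft_kronecker_one M

/-! ### Approximating a basis map -/

/-- The modulus of a matrix entry is at most the operator norm of the matrix. -/
theorem norm_apply_le_norm_toEuclideanCLM {G : Type*} [Fintype G] [DecidableEq G]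
    (A : Matrix G G ℂ) (i j : G) : ‖A i j‖ ≤ ‖Matrix.toEuclideanCLM (𝕜 := ℂ) A‖ := by
  have h := (Matrix.toEuclideanCLM (𝕜 := ℂ) A).le_opNorm (EuclideanSpace.single j 1)
  have hi := PiLp.norm_apply_le
    (Matrix.toEuclideanCLM (𝕜 := ℂ) A (EuclideanSpace.single j 1)) i
  simpa [Matrix.ofLp_toEuclideanCLM] using hi.trans h

/-- If a matrix that normalizes the Pauli operators is closer than `1 / 2` in operator norm to the
map `|h⟩ ↦ |f h⟩`, then `f` is affine. -/
theorem map_add_of_norm_sub_basisMap_le {G : Type*} [AddCommGroup G] [Fintype G] [DecidableEq G]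
    {A : Matrix G G ℂ} (hA : NormalizesPaulis A) {f : G → G} {ε : ℝ} (hε : ε < 1 / 2)
    (hAf : ‖Matrix.toEuclideanCLM (𝕜 := ℂ) A - Matrix.toEuclideanCLM (𝕜 := ℂ) (basisMap f)‖ ≤ ε)
    (g h : G) : f (h + g) + f 0 = f h + f g := by
  have entry (i j : G) : ‖A i j - basisMap f i j‖ ≤ ε := by
    rw [← map_sub] at hAf
    exact (norm_apply_le_norm_toEuclideanCLM (A - basisMap f) i j).trans hAf
  have large (j : G) : 1 - ε ≤ ‖A (f j) j‖ := by
    have h1 := entry (f j) j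
    have h2 := norm_sub_norm_le (1 : ℂ) (A (f j) j)
    rw [norm_sub_rev, norm_one] at h2
    simp only [basisMap, Matrix.of_apply, if_true] at h1
    linarith
  have small {i j : G} (hij : i ≠ f j) : ‖A i j‖ ≤ ε := by
    simpa [basisMap, hij] using entry i j
  obtain ⟨u, χ, c, hu⟩ := hA g 1
  have translate (h : G) : f (h + g) = f h + u := by
    by_contra hne
    -- The two entries that the Pauli relation compares have equal modulus, but only the first one
    -- lies at a position where `basisMap f` is nonzero.
    have hnorm := congrArg norm (hu (f (h + g)) h)
    simp only [norm_mul, Circle.norm_coe, one_mul, mul_one] at hnorm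
    have hl := large (h + g)
    have hs := small (i := f (h + g) - u) (j := h) (by rwa [ne_eq, sub_eq_iff_eq_add])
    linarith
  have h0 := translate 0
  rw [zero_add] at h0
  rw [translate h, h0]
  abel

theorem one_sub_two_rpow_neg_half_lt : 1 - (2 : ℝ) ^ (-(1 / 2) : ℝ) < 1 / 2 := by
  have h : (2 : ℝ) ^ (-1 : ℝ) < (2 : ℝ) ^ (-(1 / 2) : ℝ) :=
    Real.rpow_lt_rpow_of_exponent_lt (by norm_num) (by norm_num)
  rw [Real.rpow_neg_one] at h
  linarith

/-! ### Modular exponentiation -/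

/-- If `(m, x) ↦ (m, a ^ m x)` is affine on `ℤ_M × 𝐁`, then `a ^ M = 1`. -/
theorem orderOf_dvd_of_modularExponentiation_affine {M : ℕ} [NeZero M] {B : Type*} [CommGroup B]
    (a : B) (hM : 2 ≤ M) (f : LabelGroup M B → LabelGroup M B)
    (hf : f = fun p => (p.1, Additive.ofMul (a ^ p.1.val * p.2.toMul)))
    (hadd : ∀ g h, f (h + g) + f 0 = f h + f g) : orderOf a ∣ M := by
  have hf0 : f 0 = 0 := by simp [hf]
  let F : LabelGroup M B →+ LabelGroup M B :=
    { toFun := f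
      map_zero' := hf0
      map_add' := fun h g => by simpa [hf0] using hadd g h }
  have : Fact (1 < M) := ⟨hM⟩
  have h1 : F (1, 0) = (1, Additive.ofMul a) := by
    change f (1, 0) = _
    simp [hf, ZMod.val_one]
  have hM0 : M • ((1, 0) : LabelGroup M B) = 0 := by simp
  have h2 := map_nsmul F M (1, 0)
  rw [hM0, map_zero, h1, Prod.smul_mk, ← ofMul_pow] at h2
  exact orderOf_dvd_of_pow_eq_one (ofMul_eq_zero.mp (Prod.ext_iff.mp h2).2.symm)

end NormalizerCircuits

theorem mainTheorem8 (M : ℕ) [NeZero M] (hM : 2 ≤ M)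
    (B : Type*) [CommGroup B] [Fintype B] [DecidableEq B]
    (a : B) (ha : ¬ orderOf a ∣ M) :
    ¬ ∃ C : List (NormalizerCircuits.NormalizerGate M B),
      ‖NormalizerCircuits.circuitOperator C - NormalizerCircuits.modularExponentiation M a‖ ≤
        1 - (2 : ℝ) ^ (-(1 / 2) : ℝ) := by
  rintro ⟨C, hC⟩
  exact ha (NormalizerCircuits.orderOf_dvd_of_modularExponentiation_affine a hM _ rfl
    (NormalizerCircuits.map_add_of_norm_sub_basisMap_le
      (NormalizerCircuits.normalizesPaulis_circuitMatrix C)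
      NormalizerCircuits.one_sub_two_rpow_neg_half_lt hC))
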